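/- Let $n\ge 1$ be an integer and let $\zeta_n\in\mathbb{C}$ be a primitive $n$-th root of unity. For a multi-index $\mathbf{p}=(p_1,\ldots,p_c)$ of positive integers, of depth $\operatorname{dep}(\mathbf{p})=c$, put $$\overline{z}_n(\mathbf{p};\zeta_n)=\sum_{n>m_1>\cdots>m_c>0}\ \prod_{j=1}^{c}\frac{\zeta_n^{(p_j-1)m_j}}{(1-\zeta_n^{m_j})^{p_j}} .$$ Let $t$ be a formal parameter. For a multi-index $(k_1,\ldots,k_l)$ of positive integers with $l\ge 1$ put $$\overline{z}_n^{\,t}(k_1,\ldots,k_l;\zeta_n)=\sum_{\mathbf{p}}\overline{z}_n(\mathbf{p};\zeta_n)\,t^{\,l-\operatorname{dep}(\mathbf{p})}\in\mathbb{C}[t],$$ where $\mathbf{p}$ runs over the $3^{l-1}$ expressions $(k_1\Box k_2\Box\cdots\Box k_l)$ in which each box $\Box$ is filled by "$,$", by "$+$" or by "$-1+$" (different fillings that give the same multi-index are counted separately); for the empty multi-index ($l=0$) put $\overline{z}_n^{\,t}(\emptyset;\zeta_n)=1$. Write $\{k\}^l$ for $k$ repeated $l$ times. Then, for every integer $l\ge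 0$, the following identities hold in $\mathbb{C}[t]$: $$\overline{z}_n^{\,t}(\{1\}^l;\zeta_n)=\sum_{m=0}^{l}\frac{(-1)^m}{n^{m+1}}\sum_{(i_0,\ldots,i_m)}\left(\prod_{a=0}^{m}\binom{n}{i_a+1}\right)(1-t)^{i_0}(-t)^{l-i_0},$$ $$\overline{z}_n^{\,t}(\{2\}^l;\zeta_n)=\sum_{m=0}^{l}\frac{(-1)^m}{n^{m+1}}\sum_{(i_0,\ldots,i_m)}\left(\prod_{a=0}^{m}\frac{1}{i_a+1}\binom{n+i_a}{2i_a+1}\right)(t-1)^{i_0}t^{\,l-i_0},$$ $$\overline{z}_n^{\,t}(\{3\}^l;\zeta_n)=\sum_{m=0}^{l}\frac{(-1)^m}{n^{2m+2}}\sum_{(i_0,\ldots,i_m)}\left(\prod_{a=0}^{m}\frac{1}{i_a+1}\left[\binom{n+i_a}{3i_a+2}+(-1)^{i_a}\binom{n+2i_a+1}{3i_a+2}\right]\right)(t-1)^{i_0}t^{\,l-i_0},$$ where in each formula the inner sum runs over all tuples of integers $(i_0,\ldots,i_m)$ with $i_0+\cdots+i_m=l$, $0\le i_0\le n-1$ and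 $1\le i_1,\ldots,i_m\le n-1$. -/

import Mathlib

open Polynomial

/-- The finite multiple harmonic `q`-series (modified version)
`∑_{n > m₁ > ⋯ > m_l > 0} ∏_j q^((k_j - 1) m_j) / (1 - q^(m_j))^(k_j)`
of a multi-index `k = (k₁, …, k_l)` of positive integers. The index `()` of depth `0` gives `1`. -/
noncomputable def zbar (n : ℕ) (q : ℂ) (k : List ℕ) : ℂ :=
  ∑ m ∈ (Fintype.piFinset fun _ : Fin k.length => Finset.Ioo 0 n) with StrictAnti m,
    ∏ j, q ^ ((k.get j - 1) * m j) / (1 - q ^ m j) ^ k.get j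

/-- The three possible fillings of a box: `,` or `+` or `-1+`. -/
inductive Box
  | comma
  | plus
  | minusOnePlus
  deriving DecidableEq

instance : Fintype Box :=
  ⟨{Box.comma, Box.plus, Box.minusOnePlus}, fun b => by cases b <;> simp⟩

/-- `fill k₁ [(□₁, k₂), …, (□_{l-1}, k_l)]` is the multi-index `(k₁ □₁ k₂ □₂ ⋯ □_{l-1} k_l)`. -/
def fill : ℕ → List (Box × ℕ) → List ℕ
  | a, [] => [a]
  | a, (Box.comma, b) :: r => a :: fill b r
  | a, (Box.plus, b) :: r => fill (a + b) r
  | a, (Box.minusOnePlus, b) :: r => fill (a - 1 + b) r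

/-- Filling the boxes of an index with positive entries gives an index with positive entries, so
the truncated subtractions in `fill` and `zbar` are genuine ones. -/
theorem fill_pos (r : List (Box × ℕ)) (hr : ∀ x ∈ r, 0 < x.2) (a : ℕ) (ha : 0 < a) :
    ∀ p ∈ fill a r, 0 < p := by
  induction r generalizing a with
  | nil => simpa [fill] using ha
  | cons x r ih =>
    obtain ⟨b, c⟩ := x
    have hc : 0 < c := hr (b, c) (by simp)
    have hr' : ∀ x ∈ r, 0 < x.2 := fun x hx => hr x (List.mem_cons_of_mem _ hx)
    cases b with
    | comma =>
      intro p hp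
      rcases List.mem_cons.1 hp with h | h
      · omega
      · exact ih hr' c hc p h
    | plus => exact ih hr' (a + c) (by omega)
    | minusOnePlus => exact ih hr' (a - 1 + c) (by omega)

/-- The interpolated series, a polynomial in the formal parameter `t = X`: the sum of
`zbar(p) t^(l - dep p)` over all fillings `p` of the `l - 1` boxes of `(k₁ □ ⋯ □ k_l)`
(counted with multiplicity). The index of depth `0` gives `1`. -/
noncomputable def zbarT (n : ℕ) (q : ℂ) : List ℕ → ℂ[X]
  | [] => 1
  | k :: ks =>
    ∑ b : Fin ks.length → Box,
      C (zbar n q (fill k (List.ofFn fun j => (b j, ks.get j)))) *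
        X ^ (ks.length + 1 - (fill k (List.ofFn fun j => (b j, ks.get j))).length)

/-- The tuples `(i₀, …, i_m)` with `i₀ + ⋯ + i_m = l`, `0 ≤ i₀ ≤ n - 1` and
`1 ≤ i₁, …, i_m ≤ n - 1`. -/
def boundedCompositions (n l m : ℕ) : Finset (Fin (m + 1) → ℕ) :=
  {i ∈ Fintype.piFinset fun _ : Fin (m + 1) => Finset.range n |
    ∑ a, i a = l ∧ ∀ a, a ≠ 0 → 1 ≤ i a}

/-! Fix q = ζ, let only the bound n vary, and put w_m = q^((k-1)m)/(1-q^m)^k and r_m = q^m/(1-q^m).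
Since 1/(1-q^m) = 1 + r_m, one has w_m = r_m^k + r_m^(k-1): the fillings `+` and `-1+` together
merge an entry k into the variable m with total factor t·w_m. Splitting off the largest variable
therefore gives, for F_n = Σ_l z_n^t({k}^l) x^l, the recursion F_{n+1}(1 - t w_n x) = F_n(1 + (1-t)
w_n x) (`zbarT_succ_replicate`, `zbarSeries_succ`). Hence F_n = D((1-t)x)/D(-tx) with D(y) =
∏_{0<m<n} (1 + w_m y). Expanding 1/D geometrically in D - 1 yields the tuples: i_0 comes from the
numerator, and i_1, ..., i_m ≥ 1 from the factors D - 1. It remains to expand D(±v) for k = 1, 2, 3.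
Each factor splits over (1-q^m)^k into k linear factors in q^m, so the factorization of X^n - y^n
evaluates the product. For k = 2, 3 the result is a combination of power sums of the roots, whose
linear recurrence in n is also satisfied by the binomial expressions. -/

/-! ### Splitting off the largest summation variable. -/

theorem zbar_nil (n : ℕ) (q : ℂ) : zbar n q [] = 1 := by
  unfold zbar
  rw [Finset.filter_true_of_mem fun m _ i => i.elim0]
  exact (Finset.sum_congr rfl fun m _ => Fin.prod_univ_zero _).trans (by simp)

theorem zbar_one_cons (q : ℂ) (p : ℕ) (ps : List ℕ) : zbar 1 q (p :: ps) = 0 := by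
  unfold zbar
  apply Finset.sum_eq_zero
  intro m hm
  have := (Fintype.mem_piFinset.1 (Finset.mem_filter.1 hm).1) ⟨0, by simp⟩
  simp only [Finset.mem_Ioo] at this
  omega

theorem strictAnti_cons_iff {l : ℕ} (a : ℕ) (m : Fin l → ℕ) :
    StrictAnti (Fin.cons a m : Fin (l + 1) → ℕ) ↔ (∀ j, m j < a) ∧ StrictAnti m := by
  constructor
  · intro h
    refine ⟨fun j => by simpa using h (Fin.succ_pos j), fun i j hij => ?_⟩
    simpa using h (Fin.succ_lt_succ_iff.2 hij)
  · rintro ⟨h1, h2⟩ i j hij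
    induction j using Fin.cases with
    | zero => exact absurd hij (Fin.not_lt_zero i)
    | succ j =>
      induction i using Fin.cases with
      | zero => simpa using h1 j
      | succ i => simpa using h2 (Fin.succ_lt_succ_iff.1 hij)

theorem zbar_succ_cons (n : ℕ) (hn : 1 ≤ n) (q : ℂ) (p : ℕ) (ps : List ℕ) :
    zbar (n + 1) q (p :: ps) =
      zbar n q (p :: ps) + q ^ ((p - 1) * n) / (1 - q ^ n) ^ p * zbar n q ps := by
  unfold zbar
  -- Tuples below n + 1 either start with n or stay below n entirely, since the first entry is the
  -- largest.
  refine (Finset.sum_filter_not_add_sum_filter (ι := Fin (ps.length + 1) → ℕ) _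
    (fun m => m 0 = n) _).symm.trans ?_
  congr 1
  · refine Finset.sum_congr ?_ fun _ _ => rfl
    ext m
    simp only [Finset.mem_filter, Fintype.mem_piFinset, Finset.mem_Ioo]
    constructor
    · rintro ⟨⟨h1, h2⟩, h3⟩
      refine ⟨fun a => ⟨(h1 a).1, ?_⟩, h2⟩
      have h4 : m a ≤ m 0 := h2.antitone (Fin.zero_le _)
      have := (h1 0).2
      omega
    · rintro ⟨h1, h2⟩
      refine ⟨⟨fun a => ⟨(h1 a).1, by have := (h1 a).2; omega⟩, h2⟩, ?_⟩
      have := (h1 0).2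
      omega
  · rw [Finset.mul_sum]
    symm
    refine Finset.sum_bij' (fun (m : Fin ps.length → ℕ) _ => (Fin.cons n m : Fin (ps.length + 1) → ℕ))
      (fun (m : Fin (ps.length + 1) → ℕ) _ => Fin.tail m) ?_ ?_ ?_ ?_ ?_
    · intro m hm
      simp only [Finset.mem_filter, Fintype.mem_piFinset, Finset.mem_Ioo] at hm ⊢
      refine ⟨⟨fun a => ?_, (strictAnti_cons_iff n m).2 ⟨fun j => (hm.1 j).2, hm.2⟩⟩, by simp⟩
      refine Fin.cases ?_ (fun j => ?_) a
      · simp; omega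
      · have := hm.1 j
        simp; omega
    · intro m hm
      simp only [Finset.mem_filter, Fintype.mem_piFinset, Finset.mem_Ioo] at hm ⊢
      obtain ⟨⟨h1, h2⟩, h3⟩ := hm
      have h4 : m = (Fin.cons n (Fin.tail m) : Fin (ps.length + 1) → ℕ) := by
        rw [← h3]; exact (Fin.cons_self_tail m).symm
      rw [h4] at h2
      have h5 := (strictAnti_cons_iff _ _).1 h2
      exact ⟨fun a => ⟨(h1 a.succ).1, h5.1 a⟩, h5.2⟩
    · intro m hm
      simp
    · intro m hm
      simp only [Finset.mem_filter] at hm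
      rw [← hm.2]
      exact Fin.cons_self_tail m
    · intro m hm
      exact (Fin.prod_univ_succ (n := ps.length) (fun j : Fin (ps.length + 1) =>
        q ^ (((p :: ps).get j - 1) * (Fin.cons n m : Fin (ps.length + 1) → ℕ) j) /
          (1 - q ^ (Fin.cons n m : Fin (ps.length + 1) → ℕ) j) ^ (p :: ps).get j)).symm

/-! ### Sums over fillings and the recursion in n. -/

/-- The sum of `ψ p * t ^ (l - dep p)` over all fillings `p` of the boxes of `(a □ c₁ □ ⋯)`. -/
noncomputable def fillSum (ψ : List ℕ → ℂ) (a : ℕ) (cs : List ℕ) : ℂ[X] :=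
  ∑ b : Fin cs.length → Box,
    C (ψ (fill a (List.ofFn fun j => (b j, cs.get j)))) *
      X ^ (cs.length + 1 - (fill a (List.ofFn fun j => (b j, cs.get j))).length)

theorem length_fill_le (a : ℕ) (r : List (Box × ℕ)) : (fill a r).length ≤ r.length + 1 := by
  induction r generalizing a with
  | nil => simp [fill]
  | cons x r ih =>
    obtain ⟨b, c⟩ := x
    cases b with
    | comma => simpa [fill] using ih c
    | plus => simpa [fill] using (ih (a + c)).trans (Nat.le_succ _)
    | minusOnePlus => simpa [fill] using (ih (a - 1 + c)).trans (Nat.le_succ _)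

theorem fill_ne_nil (a : ℕ) (r : List (Box × ℕ)) : fill a r ≠ [] := by
  induction r generalizing a with
  | nil => simp [fill]
  | cons x r ih =>
    obtain ⟨b, c⟩ := x
    cases b with
    | comma => simp [fill]
    | plus => exact ih _
    | minusOnePlus => exact ih _

theorem fillSum_nil (ψ : List ℕ → ℂ) (a : ℕ) : fillSum ψ a [] = C (ψ [a]) := by
  simp [fillSum, fill]

theorem Box.sum_univ {M : Type*} [AddCommMonoid M] (f : Box → M) :
    ∑ b, f b = f .comma + f .plus + f .minusOnePlus := by
  have h : (Finset.univ : Finset Box) = {Box.comma, Box.plus, Box.minusOnePlus} := rfl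
  rw [h, Finset.sum_insert (by simp), Finset.sum_insert (by simp), Finset.sum_singleton, add_assoc]

theorem fillSum_cons (ψ : List ℕ → ℂ) (a c : ℕ) (cs : List ℕ) :
    fillSum ψ a (c :: cs) = fillSum (fun p => ψ (a :: p)) c cs + X * fillSum ψ (a + c) cs +
      X * fillSum ψ (a - 1 + c) cs := by
  -- A merge loses one entry, hence the extra factor t; `length_fill_le` keeps the subtraction from
  -- truncating.
  have key (a : ℕ) (b : Fin cs.length → Box) :
      (X : ℂ[X]) ^ (cs.length + 1 + 1 - (fill a (List.ofFn fun j => (b j, cs.get j))).length) =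
      X * X ^ (cs.length + 1 - (fill a (List.ofFn fun j => (b j, cs.get j))).length) := by
    rw [← pow_succ']
    congr 1
    have := length_fill_le a (List.ofFn fun j => (b j, cs.get j))
    rw [List.length_ofFn] at this
    omega
  have h (f : (Fin (cs.length + 1) → Box) → ℂ[X]) :
      ∑ b, f b = ∑ x : Box × (Fin cs.length → Box), f (Fin.cons x.1 x.2) :=
    ((Fin.consEquiv (fun _ : Fin (cs.length + 1) => Box)).sum_comp f).symm
  refine (h fun b => C (ψ (fill a (List.ofFn fun j => (b j, (c :: cs).get j)))) *
    X ^ (cs.length + 1 + 1 -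
      (fill a (List.ofFn fun j => (b j, (c :: cs).get j))).length)).trans ?_
  rw [Fintype.sum_prod_type, Box.sum_univ]
  unfold fillSum
  rw [Finset.mul_sum, Finset.mul_sum]
  refine congrArg₂ (· + ·) (congrArg₂ (· + ·) ?_ ?_) ?_
  · refine Finset.sum_congr rfl fun b _ => ?_
    simp [List.ofFn_succ, fill]
  all_goals
    refine Finset.sum_congr rfl fun b _ => ?_
    simp only [mul_left_comm X, ← key]
    simp [List.ofFn_succ, fill]

theorem fillSum_congr_add {ψ φ χ : List ℕ → ℂ} (h : ∀ p ps, ψ (p :: ps) = φ (p :: ps) + χ (p :: ps))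
    (a : ℕ) (cs : List ℕ) : fillSum ψ a cs = fillSum φ a cs + fillSum χ a cs := by
  unfold fillSum
  rw [← Finset.sum_add_distrib]
  refine Finset.sum_congr rfl fun b _ => ?_
  obtain ⟨p, ps, hp⟩ := List.exists_cons_of_ne_nil
    (fill_ne_nil a (List.ofFn fun j => (b j, cs.get j)))
  rw [hp, h, C_add, add_mul]

theorem fillSum_const_mul (x : ℂ) (ψ : List ℕ → ℂ) (a : ℕ) (cs : List ℕ) :
    fillSum (fun p => x * ψ p) a cs = C x * fillSum ψ a cs := by
  unfold fillSum
  rw [Finset.mul_sum]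
  exact Finset.sum_congr rfl fun b _ => by rw [C_mul, mul_assoc]

/-- The summand of `zbar (n + 1)` over the tuples with largest entry `n`. -/
noncomputable def headTerm (n : ℕ) (q : ℂ) : List ℕ → ℂ
  | [] => 0
  | p :: ps => q ^ ((p - 1) * n) / (1 - q ^ n) ^ p * zbar n q ps

/-- Raising the first entry by one raises the first entry of every filled index by one and leaves
the rest alone, so each head term gains the factor r_n. Positivity of a keeps a - 1 genuine under
`-1+`. -/
theorem fillSum_headTerm_succ (n : ℕ) (q : ℂ) (cs : List ℕ) (hcs : ∀ c ∈ cs, 1 ≤ c)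
    (a : ℕ) (ha : 1 ≤ a) :
    fillSum (headTerm n q) (a + 1) cs =
      C (q ^ n / (1 - q ^ n)) * fillSum (headTerm n q) a cs := by
  have hf (a : ℕ) (ha : 1 ≤ a) : q ^ ((a + 1 - 1) * n) / (1 - q ^ n) ^ (a + 1) =
      q ^ n / (1 - q ^ n) * (q ^ ((a - 1) * n) / (1 - q ^ n) ^ a) := by
    obtain ⟨a, rfl⟩ := Nat.exists_eq_add_of_le' ha
    rw [div_mul_div_comm, ← pow_add, ← pow_succ']
    congr 2
    simp
    ring
  induction cs generalizing a with
  | nil => rw [fillSum_nil, fillSum_nil, ← C_mul, headTerm, headTerm, hf a ha, mul_assoc]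
  | cons c cs ih =>
    have hc : 1 ≤ c := hcs c (by simp)
    have ih' := ih (fun c hc => hcs c (List.mem_cons_of_mem _ hc))
    have h1 (a : ℕ) : fillSum (fun p => headTerm n q (a :: p)) c cs =
        C (q ^ ((a - 1) * n) / (1 - q ^ n) ^ a) * fillSum (zbar n q) c cs :=
      fillSum_const_mul _ _ _ _
    rw [fillSum_cons, fillSum_cons, h1, h1, hf a ha, C_mul,
      show a + 1 + c = a + c + 1 by ring, ih' (a + c) (by omega),
      show a + 1 - 1 + c = a - 1 + c + 1 by omega, ih' (a - 1 + c) (by omega)]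
    ring

theorem fillSum_headTerm_add (n : ℕ) (q : ℂ) (cs : List ℕ) (hcs : ∀ c ∈ cs, 1 ≤ c)
    (a : ℕ) (ha : 1 ≤ a) (k : ℕ) :
    fillSum (headTerm n q) (a + k) cs =
      C ((q ^ n / (1 - q ^ n)) ^ k) * fillSum (headTerm n q) a cs := by
  induction k with
  | zero => simp
  | succ k ih =>
    rw [← add_assoc, fillSum_headTerm_succ n q cs hcs (a + k) (by omega), ih, pow_succ', C_mul,
      mul_assoc]

/-- The fillings `+` and `-1+` contribute r_n^k and r_n^(k-1), which add up to w_n. This is the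
reason for the third filling. -/
theorem fillSum_headTerm_cons (n : ℕ) (q : ℂ) (hq : 1 - q ^ n ≠ 0) (cs : List ℕ)
    (hcs : ∀ c ∈ cs, 1 ≤ c) (a : ℕ) (ha : 1 ≤ a) (k : ℕ) (hk : 1 ≤ k) :
    fillSum (headTerm n q) a (k :: cs) =
      C (q ^ ((a - 1) * n) / (1 - q ^ n) ^ a) * fillSum (zbar n q) k cs +
      X * C (q ^ ((k - 1) * n) / (1 - q ^ n) ^ k) * fillSum (headTerm n q) a cs := by
  obtain ⟨k, rfl⟩ := Nat.exists_eq_add_of_le' hk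
  have h1 : fillSum (fun p => headTerm n q (a :: p)) (k + 1) cs =
        C (q ^ ((a - 1) * n) / (1 - q ^ n) ^ a) * fillSum (zbar n q) (k + 1) cs :=
      fillSum_const_mul _ _ _ _
  have h2 : q ^ ((k + 1 - 1) * n) / (1 - q ^ n) ^ (k + 1) =
      (q ^ n / (1 - q ^ n)) ^ (k + 1) + (q ^ n / (1 - q ^ n)) ^ k := by
    rw [Nat.add_sub_cancel, mul_comm, pow_mul, div_pow, div_pow]
    field_simp
    ring
  rw [fillSum_cons, h1, show a - 1 + (k + 1) = a + k by omega, fillSum_headTerm_add n q cs hcs a ha,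
    fillSum_headTerm_add n q cs hcs a ha, h2, C_add]
  ring

theorem zbarT_cons (n : ℕ) (q : ℂ) (k : ℕ) (ks : List ℕ) :
    zbarT n q (k :: ks) = fillSum (zbar n q) k ks := rfl

theorem zbarT_one_cons (q : ℂ) (k : ℕ) (ks : List ℕ) : zbarT 1 q (k :: ks) = 0 := by
  rw [zbarT_cons, fillSum]
  refine Finset.sum_eq_zero fun b _ => ?_
  obtain ⟨p, ps, hp⟩ := List.exists_cons_of_ne_nil
    (fill_ne_nil k (List.ofFn fun j => (b j, ks.get j)))
  rw [hp, zbar_one_cons, C_0, zero_mul]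

theorem zbarT_succ_replicate (n : ℕ) (hn : 1 ≤ n) (q : ℂ) (hq : 1 - q ^ n ≠ 0) (k : ℕ)
    (hk : 1 ≤ k) (l : ℕ) :
    zbarT (n + 1) q (List.replicate (l + 1) k) -
        X * C (q ^ ((k - 1) * n) / (1 - q ^ n) ^ k) * zbarT (n + 1) q (List.replicate l k) =
      zbarT n q (List.replicate (l + 1) k) +
        (1 - X) * C (q ^ ((k - 1) * n) / (1 - q ^ n) ^ k) * zbarT n q (List.replicate l k) := by
  have hstep (l : ℕ) : zbarT (n + 1) q (List.replicate (l + 1) k) =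
      zbarT n q (List.replicate (l + 1) k) + fillSum (headTerm n q) k (List.replicate l k) :=
    fillSum_congr_add (fun p ps => zbar_succ_cons n hn q p ps) _ _
  rw [hstep]
  cases l with
  -- The empty index is not a sum over fillings, so it is treated apart.
  | zero =>
    rw [List.replicate_zero, fillSum_nil, headTerm, zbar_nil]
    simp only [zbarT, mul_one]
    ring
  | succ l =>
    rw [hstep l]
    have h := fillSum_headTerm_cons n q hq (List.replicate l k)
      (fun c hc => by rw [List.eq_of_mem_replicate hc]; exact hk) k hk k hk
    rw [List.replicate_succ (n := l), h, zbarT_cons n q k (List.replicate l k)]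
    ring

/-! ### Coefficients of a quotient of power series. -/

theorem coeff_mul_pow_eq_sum_boundedCompositions {R : Type*} [CommRing R] (n : ℕ) (f g : ℕ → R)
    (hg : g 0 = 0) (l m : ℕ) :
    PowerSeries.coeff l ((∑ i ∈ Finset.range n, PowerSeries.monomial i (f i)) *
      (∑ i ∈ Finset.range n, PowerSeries.monomial i (g i)) ^ m) =
    ∑ i ∈ boundedCompositions n l m, f (i 0) * ∏ a : Fin m, g (i a.succ) := by
  let h : Fin (m + 1) → ℕ → R := Fin.cons f fun _ => g
  have h1 : (∑ i ∈ Finset.range n, PowerSeries.monomial i (f i)) *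
      (∑ i ∈ Finset.range n, PowerSeries.monomial i (g i)) ^ m =
      ∏ a, ∑ i ∈ Finset.range n, PowerSeries.monomial i (h a i) := by
    rw [Fin.prod_univ_succ]
    simp [h]
  have h2 (i : Fin (m + 1) → ℕ) : ∏ a, PowerSeries.monomial (i a) (h a (i a)) =
      PowerSeries.monomial (∑ a, i a) (∏ a, h a (i a)) := by
    simp only [PowerSeries.monomial_eq_C_mul_X_pow, Finset.prod_mul_distrib,
      Finset.prod_pow_eq_pow_sum, map_prod]
  rw [h1, Finset.prod_univ_sum, map_sum]
  simp only [h2, PowerSeries.coeff_monomial]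
  rw [← Finset.sum_filter]
  symm
  refine Finset.sum_subset_zero_on_sdiff ?_ ?_ ?_
  · intro i hi
    simp only [boundedCompositions, Finset.mem_filter] at hi ⊢
    exact ⟨hi.1, hi.2.1.symm⟩
  · intro i hi
    simp only [boundedCompositions, Finset.mem_filter, Finset.mem_sdiff] at hi
    have hi' : ¬ ∀ a, a ≠ 0 → 1 ≤ i a := fun H => hi.2 ⟨hi.1.1, hi.1.2.symm, H⟩
    push Not at hi'
    obtain ⟨a, ha, hia⟩ := hi'
    refine Finset.prod_eq_zero (Finset.mem_univ a) ?_
    obtain ⟨b, rfl⟩ := Fin.exists_succ_eq.2 ha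
    rw [show i b.succ = 0 by omega]
    simpa [h] using hg
  · intro i hi
    rw [Fin.prod_univ_succ]
    simp [h]

/-- The geometric series for 1/A can be cut off after (1 - A)^l, because X divides 1 - A and so the
remainder F(1 - A)^(l+1) has no coefficient in degree l. -/
theorem PowerSeries.coeff_eq_of_mul_eq {R : Type*} [CommRing R] (F A B : PowerSeries R)
    (hA : PowerSeries.constantCoeff A = 1) (h : F * A = B) (l : ℕ) :
    PowerSeries.coeff l F =
      ∑ m ∈ Finset.range (l + 1), (-1) ^ m * PowerSeries.coeff l (B * (A - 1) ^ m) := by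
  have h1 : F - F * (1 - A) ^ (l + 1) =
      ∑ m ∈ Finset.range (l + 1), PowerSeries.C ((-1) ^ m) * (B * (A - 1) ^ m) := by
    have h2 := mul_neg_geom_sum (1 - A) (l + 1)
    rw [← h, show F - F * (1 - A) ^ (l + 1) = F * (1 - (1 - A) ^ (l + 1)) by ring, ← h2,
      Finset.mul_sum, Finset.mul_sum]
    refine Finset.sum_congr rfl fun m _ => ?_
    rw [show (1 - A) = -1 * (A - 1) by ring, mul_pow]
    simp only [map_pow, map_neg, map_one]
    ring
  have h3 : PowerSeries.coeff l (F * (1 - A) ^ (l + 1)) = 0 := by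
    have hdvd : (PowerSeries.X : PowerSeries R) ∣ 1 - A := by
      rw [PowerSeries.X_dvd_iff, map_sub, hA, map_one, sub_self]
    have := (pow_dvd_pow_of_dvd hdvd (l + 1)).mul_left F
    exact PowerSeries.X_pow_dvd_iff.1 this l (Nat.lt_succ_self l)
  have h4 := congrArg (PowerSeries.coeff l) h1
  rw [map_sub, h3, sub_zero, map_sum] at h4
  rw [h4]
  exact Finset.sum_congr rfl fun m _ => PowerSeries.coeff_C_mul _ _ _

theorem coeff_eq_sum_boundedCompositions (n : ℕ) (hn : 1 ≤ n) (d : ℕ → ℂ) (hd : d 0 = 1)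
    (α β : ℂ[X]) (F : PowerSeries ℂ[X])
    (h : F * ∑ i ∈ Finset.range n, PowerSeries.monomial i (C (d i) * β ^ i) =
      ∑ i ∈ Finset.range n, PowerSeries.monomial i (C (d i) * α ^ i)) (l : ℕ) :
    PowerSeries.coeff l F = ∑ m ∈ Finset.range (l + 1), C ((-1 : ℂ) ^ m) *
      ∑ i ∈ boundedCompositions n l m, C (∏ a, d (i a)) * (α ^ i 0 * β ^ (l - i 0)) := by
  obtain ⟨N, rfl⟩ := Nat.exists_eq_add_of_le' hn
  have hA : PowerSeries.constantCoeff
      (∑ i ∈ Finset.range (N + 1), PowerSeries.monomial i (C (d i) * β ^ i)) = 1 := by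
    rw [Finset.sum_range_succ', map_add, map_sum, Finset.sum_eq_zero]
    · rw [← PowerSeries.coeff_zero_eq_constantCoeff_apply, PowerSeries.coeff_monomial]
      simp [hd]
    · intro i _
      rw [← PowerSeries.coeff_zero_eq_constantCoeff_apply, PowerSeries.coeff_monomial,
        if_neg (by omega)]
  have hA' : ∑ i ∈ Finset.range (N + 1), PowerSeries.monomial i (C (d i) * β ^ i) - 1 =
      ∑ i ∈ Finset.range (N + 1), PowerSeries.monomial i (if i = 0 then 0 else C (d i) * β ^ i) := by
    rw [Finset.sum_range_succ', Finset.sum_range_succ' _ N]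
    simp [hd]
  rw [PowerSeries.coeff_eq_of_mul_eq F _ _ hA h l]
  refine Finset.sum_congr rfl fun m _ => ?_
  rw [hA', coeff_mul_pow_eq_sum_boundedCompositions _ _ _ (by simp)]
  congr 1
  · simp
  refine Finset.sum_congr rfl fun i hi => ?_
  simp only [boundedCompositions, Finset.mem_filter] at hi
  have h5 : ∏ a : Fin m, (if i a.succ = 0 then 0 else C (d (i a.succ)) * β ^ i a.succ) =
      C (∏ a : Fin m, d (i a.succ)) * β ^ (l - i 0) := by
    have h6 : l - i 0 = ∑ a : Fin m, i a.succ := by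
      rw [← hi.2.1, Fin.sum_univ_succ, Nat.add_sub_cancel_left]
    rw [h6, ← Finset.prod_pow_eq_pow_sum, map_prod, ← Finset.prod_mul_distrib]
    refine Finset.prod_congr rfl fun a _ => if_neg ?_
    have := hi.2.2 a.succ (Fin.succ_ne_zero a)
    omega
  rw [h5, Fin.prod_univ_succ, C_mul]
  ring

/-! ### The generating series as a quotient of products. -/

/-- The generating series of `zbarT n q ({k}^l)` over `l`. -/
noncomputable def zbarSeries (n : ℕ) (q : ℂ) (k : ℕ) : PowerSeries ℂ[X] :=
  PowerSeries.mk fun l => zbarT n q (List.replicate l k)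

theorem zbarSeries_one (q : ℂ) (k : ℕ) : zbarSeries 1 q k = 1 := by
  ext1 l
  rw [zbarSeries, PowerSeries.coeff_mk, PowerSeries.coeff_one]
  cases l with
  | zero => simp [zbarT]
  | succ l => rw [List.replicate_succ, zbarT_one_cons, if_neg (by omega)]

theorem zbarSeries_succ (n : ℕ) (hn : 1 ≤ n) (q : ℂ) (hq : 1 - q ^ n ≠ 0) (k : ℕ) (hk : 1 ≤ k) :
    zbarSeries (n + 1) q k *
        (1 - PowerSeries.C (X * C (q ^ ((k - 1) * n) / (1 - q ^ n) ^ k)) * PowerSeries.X) =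
      zbarSeries n q k *
        (1 + PowerSeries.C ((1 - X) * C (q ^ ((k - 1) * n) / (1 - q ^ n) ^ k)) * PowerSeries.X) := by
  rw [mul_sub, mul_add, mul_one, mul_one, mul_left_comm, mul_left_comm (zbarSeries n q k)]
  ext1 l
  rw [map_sub, map_add, PowerSeries.coeff_C_mul, PowerSeries.coeff_C_mul]
  cases l with
  | zero => simp [zbarSeries, zbarT]
  | succ l =>
    simp only [PowerSeries.coeff_succ_mul_X, zbarSeries, PowerSeries.coeff_mk]
    exact zbarT_succ_replicate n hn q hq k hk l

theorem zbarSeries_mul_prod (n : ℕ) (q : ℂ) (k : ℕ) (hk : 1 ≤ k)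
    (hq : ∀ m < n, 1 - q ^ (m + 1) ≠ 0) :
    zbarSeries (n + 1) q k * ∏ m ∈ Finset.range n,
        (1 - PowerSeries.C (X * C (q ^ ((k - 1) * (m + 1)) / (1 - q ^ (m + 1)) ^ k)) *
          PowerSeries.X) =
      ∏ m ∈ Finset.range n,
        (1 + PowerSeries.C ((1 - X) * C (q ^ ((k - 1) * (m + 1)) / (1 - q ^ (m + 1)) ^ k)) *
          PowerSeries.X) := by
  induction n with
  | zero => simp [zbarSeries_one]
  | succ n ih =>
    rw [Finset.prod_range_succ, Finset.prod_range_succ, ← ih fun m hm => hq m (by omega),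
      mul_left_comm, zbarSeries_succ (n + 1) (by omega) q (hq n (by omega)) k hk]
    ring

theorem zbarT_replicate_eq (n : ℕ) (q : ℂ) (k : ℕ) (hk : 1 ≤ k)
    (hq : ∀ m < n, 1 - q ^ (m + 1) ≠ 0) (ε : ℂ) (hε : ε * ε = 1) (d : ℕ → ℂ)
    (hd : ∏ m ∈ Finset.range n,
      (1 + C (ε * (q ^ ((k - 1) * (m + 1)) / (1 - q ^ (m + 1)) ^ k)) * X) =
      ∑ i ∈ Finset.range (n + 1), C (d i) * X ^ i) (l : ℕ) :
    zbarT (n + 1) q (List.replicate l k) = ∑ m ∈ Finset.range (l + 1), C ((-1 : ℂ) ^ m) *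
      ∑ i ∈ boundedCompositions (n + 1) l m,
        C (∏ a, d (i a)) * ((C ε * (1 - X)) ^ i 0 * (C ε * -X) ^ (l - i 0)) := by
  have hd0 : d 0 = 1 := by
    have h := congrArg (Polynomial.eval 0) hd
    rw [Finset.sum_range_succ'] at h
    simpa [eval_prod, eval_finsetSum] using h.symm
  have hC : C ε * C ε = (1 : ℂ[X]) := by rw [← C_mul, hε, C_1]
  -- Substitute αX for the variable in `hd`, with values in power series over ℂ[X].
  have key (α : ℂ[X]) : ∏ m ∈ Finset.range n, (1 + PowerSeries.C
      (C (ε * (q ^ ((k - 1) * (m + 1)) / (1 - q ^ (m + 1)) ^ k)) * α) * PowerSeries.X) =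
      ∑ i ∈ Finset.range (n + 1), PowerSeries.monomial i (C (d i) * α ^ i) := by
    have h := congrArg (Polynomial.eval₂RingHom
      ((PowerSeries.C (R := ℂ[X])).comp Polynomial.C) (PowerSeries.C α * PowerSeries.X)) hd
    simp only [map_prod, map_sum, map_add, map_one, map_mul, map_pow, coe_eval₂RingHom, eval₂_C,
      eval₂_X, RingHom.comp_apply] at h
    refine Eq.trans (Finset.prod_congr rfl fun m _ => ?_) (h.trans
      (Finset.sum_congr rfl fun i _ => ?_))
    · simp only [map_mul, mul_assoc]
    · rw [PowerSeries.monomial_eq_C_mul_X_pow, map_mul, map_pow, mul_pow]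
      ring
  -- The sign ε sits both in D and in the substituted values, and cancels by ε² = 1; ε = -1 produces
  -- the form (t-1)^i t^(l-i).
  have h := coeff_eq_sum_boundedCompositions (n + 1) (by omega) d hd0 (C ε * (1 - X)) (C ε * -X)
    (zbarSeries (n + 1) q k) ?_ l
  · rw [← h, zbarSeries, PowerSeries.coeff_mk]
  · rw [← key, ← key]
    refine Eq.trans ?_ ((zbarSeries_mul_prod n q k hk hq).trans ?_)
    · congr 1
      refine Finset.prod_congr rfl fun m _ => ?_
      rw [sub_eq_add_neg (1 : PowerSeries ℂ[X]), ← neg_mul, ← map_neg, C_mul]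
      congr 3
      linear_combination (-X * C (q ^ ((k - 1) * (m + 1)) / (1 - q ^ (m + 1)) ^ k)) * hC
    · refine Finset.prod_congr rfl fun m _ => ?_
      rw [C_mul]
      congr 3
      linear_combination (-(1 - X) * C (q ^ ((k - 1) * (m + 1)) / (1 - q ^ (m + 1)) ^ k)) * hC

/-! ### Roots of unity and binomial expansions of power sums. -/

theorem sub_mul_prod_sub_pow (n : ℕ) (q : ℂ) (hq : IsPrimitiveRoot q (n + 1)) (x y : ℂ) :
    (x - y) * ∏ m ∈ Finset.range n, (x - q ^ (m + 1) * y) = x ^ (n + 1) - y ^ (n + 1) := by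
  have h := congrArg (Polynomial.eval x) (X_pow_sub_C_eq_prod hq n.succ_pos (α := y) rfl)
  rw [Finset.prod_range_succ'] at h
  simp only [eval_sub, eval_pow, eval_X, eval_C, eval_mul, eval_prod, pow_zero, one_mul] at h
  rw [h, mul_comm]

theorem choose_second_difference (N K : ℕ) :
    ((N + 2).choose (K + 2) : ℂ) - 2 * (N + 1).choose (K + 2) + N.choose (K + 2) = N.choose K := by
  simp only [Nat.choose_succ_succ]
  push_cast
  ring

theorem choose_third_difference (N K : ℕ) :
    ((N + 3).choose (K + 3) : ℂ) - 3 * (N + 2).choose (K + 3) + 3 * (N + 1).choose (K + 3) -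
      N.choose (K + 3) = N.choose K := by
  simp only [Nat.choose_succ_succ]
  push_cast
  ring

theorem sum_range_shift (v : ℂ) (b : ℕ → ℂ) (n : ℕ) :
    ∑ i ∈ Finset.range (n + 1), b i * v ^ (i + 1) =
      v * ∑ i ∈ Finset.range n, b (i + 1) * v ^ (i + 1) + b 0 * v := by
  rw [Finset.sum_range_succ', Finset.mul_sum]
  congr 1
  · exact Finset.sum_congr rfl fun i _ => by ring
  · ring

theorem sum_range_extend (v : ℂ) (b : ℕ → ℂ) (n m : ℕ) (hnm : n ≤ m) (hb : ∀ i, n ≤ i → b i = 0) :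
    ∑ i ∈ Finset.range n, b i * v ^ (i + 1) = ∑ i ∈ Finset.range m, b i * v ^ (i + 1) := by
  refine Finset.sum_subset (Finset.range_subset_range.2 hnm) fun i _ hi => ?_
  rw [hb i (by simpa using hi), zero_mul]

/-- A sequence of polynomials in `v` whose coefficients satisfy a second difference relation. -/
theorem sum_range_second_difference (v c : ℂ) (b : ℕ → ℕ → ℂ) (hb : ∀ n i, n ≤ i → b n i = 0)
    (h0 : ∀ n, b (n + 2) 0 - 2 * b (n + 1) 0 + b n 0 = c)
    (hs : ∀ n i, b (n + 2) (i + 1) - 2 * b (n + 1) (i + 1) + b n (i + 1) = b (n + 1) i) (n : ℕ) :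
    ∑ i ∈ Finset.range (n + 2), b (n + 2) i * v ^ (i + 1) =
      2 * ∑ i ∈ Finset.range (n + 1), b (n + 1) i * v ^ (i + 1) -
      ∑ i ∈ Finset.range n, b n i * v ^ (i + 1) +
      v * ∑ i ∈ Finset.range (n + 1), b (n + 1) i * v ^ (i + 1) + c * v := by
  have h := sum_range_shift v (fun i => b (n + 2) i - 2 * b (n + 1) i + b n i) (n + 1)
  simp only [hs, h0] at h
  rw [sum_range_extend v (b n) n (n + 1 + 1) (by omega) (hb n)]
  nth_rw 1 [sum_range_extend v (b (n + 1)) (n + 1) (n + 1 + 1) (by omega) (hb (n + 1))]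
  rw [add_assoc, ← h, Finset.mul_sum, ← Finset.sum_sub_distrib, ← Finset.sum_add_distrib]
  exact Finset.sum_congr rfl fun i _ => by ring

theorem sum_range_third_difference (v c e : ℂ) (s : ℕ) (hs2 : s ≤ 2) (b : ℕ → ℕ → ℂ)
    (hb : ∀ n i, n ≤ i → b n i = 0)
    (h0 : ∀ n, b (n + 3) 0 - 3 * b (n + 2) 0 + 3 * b (n + 1) 0 - b n 0 = c)
    (hs : ∀ n i, b (n + 3) (i + 1) - 3 * b (n + 2) (i + 1) + 3 * b (n + 1) (i + 1) - b n (i + 1) =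
      e * b (n + s) i) (n : ℕ) :
    ∑ i ∈ Finset.range (n + 3), b (n + 3) i * v ^ (i + 1) =
      3 * ∑ i ∈ Finset.range (n + 2), b (n + 2) i * v ^ (i + 1) -
      3 * ∑ i ∈ Finset.range (n + 1), b (n + 1) i * v ^ (i + 1) +
      ∑ i ∈ Finset.range n, b n i * v ^ (i + 1) +
      v * (e * ∑ i ∈ Finset.range (n + s), b (n + s) i * v ^ (i + 1)) + c * v := by
  have h := sum_range_shift v
    (fun i => b (n + 3) i - 3 * b (n + 2) i + 3 * b (n + 1) i - b n i) (n + 2)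
  simp only [hs, h0, mul_assoc] at h
  rw [← Finset.mul_sum] at h
  rw [sum_range_extend v (b n) n (n + 2 + 1) (by omega) (hb n),
    sum_range_extend v (b (n + s)) (n + s) (n + 2) (by omega) (hb (n + s)),
    sum_range_extend v (b (n + 1)) (n + 1) (n + 2 + 1) (by omega) (hb (n + 1))]
  rw [add_assoc, ← h, sum_range_extend v (b (n + 2)) (n + 2) (n + 2 + 1) (by omega) (hb (n + 2)),
    Finset.mul_sum, Finset.mul_sum, ← Finset.sum_sub_distrib, ← Finset.sum_add_distrib,
    ← Finset.sum_add_distrib]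
  exact Finset.sum_congr rfl fun i _ => by ring

/-- Power sums satisfy p_{n+2} = (2+v)p_{n+1} - p_n. Comparing coefficients of v, this becomes a
second difference relation for the binomials, which follows from Pascal's rule. -/
theorem quadratic_power_sum (v x y : ℂ) (h1 : x + y = 2 + v) (h2 : x * y = 1) (n : ℕ) :
    x ^ n + y ^ n - 2 = ∑ i ∈ Finset.range n,
      (((n + i + 1).choose (2 * i + 2) : ℂ) + (n + i).choose (2 * i + 2)) * v ^ (i + 1) := by
  let b : ℕ → ℕ → ℂ := fun n i => ((n + i + 1).choose (2 * i + 2) : ℂ) + (n + i).choose (2 * i + 2)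
  have hrec := sum_range_second_difference v 2 b
    (fun n i hi => by
      simp only [b]
      rw [Nat.choose_eq_zero_of_lt (by omega), Nat.choose_eq_zero_of_lt (by omega)]
      simp)
    (fun n => by
      have e1 := choose_second_difference (n + 1) 0
      have e2 := choose_second_difference n 0
      simp only [Nat.choose_zero_right, Nat.cast_one, zero_add] at e1 e2
      simp only [b, mul_zero, add_zero, zero_add]
      ring_nf at e1 e2 ⊢
      linear_combination e1 + e2)
    (fun n i => by
      have e1 := choose_second_difference (n + i + 2) (2 * i + 2)
      have e2 := choose_second_difference (n + i + 1) (2 * i + 2)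
      simp only [b]
      ring_nf at e1 e2 ⊢
      linear_combination e1 + e2)
  change _ = ∑ i ∈ Finset.range n, b n i * v ^ (i + 1)
  induction n using Nat.strong_induction_on with
  | _ n ih =>
    match n, ih with
    | 0, _ => norm_num
    | 1, _ =>
      norm_num [b]
      linear_combination h1
    | n + 2, ih =>
      rw [hrec, ← ih n (by omega), ← ih (n + 1) (by omega)]
      linear_combination (x ^ (n + 1) + y ^ (n + 1)) * h1 - (x ^ n + y ^ n) * h2

theorem cubic_power_sum (v x y z : ℂ) (h1 : x + y + z = 3) (h2 : x * y + y * z + x * z = 3 - v)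
    (h3 : x * y * z = 1) (n : ℕ) :
    x ^ n + y ^ n + z ^ n - 3 = ∑ i ∈ Finset.range n,
      (3 * ((n + i + 1).choose (3 * i + 3) : ℂ) - (n + i).choose (3 * i + 2)) * v ^ (i + 1) := by
  let b : ℕ → ℕ → ℂ := fun n i =>
    3 * ((n + i + 1).choose (3 * i + 3) : ℂ) - (n + i).choose (3 * i + 2)
  have hrec := sum_range_third_difference v 3 1 1 (by omega) b
    (fun n i hi => by
      simp only [b]
      rw [Nat.choose_eq_zero_of_lt (by omega), Nat.choose_eq_zero_of_lt (by omega)]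
      simp)
    (fun n => by
      simp only [b, Nat.choose_succ_succ, Nat.choose_zero_right]
      push_cast
      ring_nf)
    (fun n i => by
      have e1 := choose_third_difference (n + i + 2) (3 * i + 3)
      have e2 := choose_third_difference (n + i + 1) (3 * i + 2)
      simp only [b]
      ring_nf at e1 e2 ⊢
      linear_combination 3 * e1 - e2)
  change _ = ∑ i ∈ Finset.range n, b n i * v ^ (i + 1)
  induction n using Nat.strong_induction_on with
  | _ n ih =>
    match n, ih with
    | 0, _ => norm_num
    | 1, _ =>
      norm_num [b, Nat.choose]
      linear_combination h1
    | 2, _ =>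
      norm_num [b, Finset.sum_range_succ, Nat.choose]
      linear_combination (x + y + z + 3) * h1 - 2 * h2
    | n + 3, ih =>
      rw [hrec, ← ih n (by omega), ← ih (n + 1) (by omega), ← ih (n + 2) (by omega)]
      linear_combination (x ^ (n + 2) + y ^ (n + 2) + z ^ (n + 2)) * h1 -
        (x ^ (n + 1) + y ^ (n + 1) + z ^ (n + 1)) * h2 + (x ^ n + y ^ n + z ^ n) * h3

/-- Companion of `cubic_power_sum` for the reciprocal roots xy, yz, xz: inversion swaps the first
two elementary symmetric functions, so v now multiplies p_{n+2} in the recurrence, with a minus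
sign. -/
theorem cubic_power_sum_inv (v x y z : ℂ) (h1 : x + y + z = 3 - v)
    (h2 : x * y + y * z + x * z = 3) (h3 : x * y * z = 1) (n : ℕ) :
    x ^ n + y ^ n + z ^ n - 3 = ∑ i ∈ Finset.range n,
      (-(-1) ^ i * (3 * ((n + 2 * i + 2).choose (3 * i + 3) : ℂ) -
        2 * (n + 2 * i + 1).choose (3 * i + 2))) * v ^ (i + 1) := by
  let b : ℕ → ℕ → ℂ := fun n i => -(-1) ^ i *
    (3 * ((n + 2 * i + 2).choose (3 * i + 3) : ℂ) - 2 * (n + 2 * i + 1).choose (3 * i + 2))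
  have hb0 (n i : ℕ) (hi : n ≤ i) : b n i = 0 := by
    simp only [b]
    rw [Nat.choose_eq_zero_of_lt (by omega), Nat.choose_eq_zero_of_lt (by omega)]
    simp
  have hrec := sum_range_third_difference v (-3) (-1) 2 (by omega) b hb0
    (fun n => by
      simp only [b, Nat.choose_succ_succ, Nat.choose_zero_right]
      push_cast
      ring_nf
      norm_num [Nat.choose_zero_right])
    (fun n i => by
      have e1 := choose_third_difference (n + 2 * i + 4) (3 * i + 3)
      have e2 := choose_third_difference (n + 2 * i + 3) (3 * i + 2)
      simp only [b]
      ring_nf at e1 e2 ⊢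
      linear_combination (-1) ^ i * (3 * e1 - 2 * e2))
  change _ = ∑ i ∈ Finset.range n, b n i * v ^ (i + 1)
  induction n using Nat.strong_induction_on with
  | _ n ih =>
    match n, ih with
    | 0, _ => norm_num
    | 1, _ =>
      norm_num [b, Nat.choose]
      linear_combination h1
    | 2, _ =>
      norm_num [b, Finset.sum_range_succ, Nat.choose]
      linear_combination (x + y + z + 3 - v) * h1 - 2 * h2
    | n + 3, ih =>
      rw [hrec, ← ih n (by omega), ← ih (n + 1) (by omega), ← ih (n + 2) (by omega)]
      linear_combination (x ^ (n + 2) + y ^ (n + 2) + z ^ (n + 2)) * h1 -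
        (x ^ (n + 1) + y ^ (n + 1) + z ^ (n + 1)) * h2 + (x ^ n + y ^ n + z ^ n) * h3

/-! ### Closed forms of D for k = 1, 2, 3. -/

theorem exists_add_mul_eq (s p : ℂ) : ∃ x y : ℂ, x + y = s ∧ x * y = p := by
  obtain ⟨δ, hδ⟩ := IsAlgClosed.exists_pow_nat_eq (s ^ 2 - 4 * p) (n := 2) (by norm_num)
  exact ⟨(s + δ) / 2, (s - δ) / 2, by ring, by linear_combination -hδ / 4⟩

theorem exists_cubic_roots (a b c : ℂ) :
    ∃ x y z : ℂ, x + y + z = a ∧ x * y + y * z + x * z = b ∧ x * y * z = c := by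
  have hdeg : (X ^ 3 - C a * X ^ 2 + C b * X - C c : ℂ[X]).degree = 3 := by compute_degree!
  obtain ⟨x, hx⟩ := IsAlgClosed.exists_root (X ^ 3 - C a * X ^ 2 + C b * X - C c : ℂ[X])
    (by rw [hdeg]; norm_num)
  obtain ⟨y, z, h1, h2⟩ := exists_add_mul_eq (a - x) (b - x * (a - x))
  simp only [IsRoot.def, eval_sub, eval_add, eval_mul, eval_pow, eval_X, eval_C] at hx
  exact ⟨x, y, z, by linear_combination h1, by linear_combination x * h1 + h2,
    by linear_combination x * h2 + hx⟩

theorem one_sub_pow_ne_zero {n : ℕ} {q : ℂ} (hq : IsPrimitiveRoot q (n + 1)) (m : ℕ) (hm : m < n) :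
    1 - q ^ (m + 1) ≠ 0 :=
  sub_ne_zero.2 (hq.pow_ne_one_of_pos_of_lt (by omega) (by omega)).symm

/-- The factor v is kept because the product over nontrivial roots of unity is known only after
multiplication by the trivial factor, which supplies v; it is cancelled in ℂ[X], so v = 0 needs no
care. -/
theorem prod_eq_sum_of_eval (n : ℕ) (w d : ℕ → ℂ)
    (h : ∀ v : ℂ, v * ∏ m ∈ Finset.range n, (1 + w m * v) =
      ∑ i ∈ Finset.range (n + 1), d i * v ^ (i + 1)) :
    ∏ m ∈ Finset.range n, (1 + C (w m) * X) = ∑ i ∈ Finset.range (n + 1), C (d i) * X ^ i := by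
  refine mul_left_cancel₀ X_ne_zero (Polynomial.funext fun v => ?_)
  simp only [eval_mul, eval_X, eval_prod, eval_add, eval_one, eval_C, eval_finsetSum, eval_pow, h,
    Finset.mul_sum]
  exact Finset.sum_congr rfl fun i _ => by ring

theorem prod_one_add_weight_one (n : ℕ) (q : ℂ) (hq : IsPrimitiveRoot q (n + 1)) :
    ∏ m ∈ Finset.range n, (1 + C (1 * (q ^ ((1 - 1) * (m + 1)) / (1 - q ^ (m + 1)) ^ 1)) * X) =
      ∑ i ∈ Finset.range (n + 1),
        C (1 / ((n + 1 : ℕ) : ℂ) * ((n + 1).choose (i + 1) : ℂ)) * X ^ i := by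
  refine prod_eq_sum_of_eval n _ _ fun v => ?_
  have h1 := sub_mul_prod_sub_pow n q hq (1 + v) 1
  have h2 := hq.prod_one_sub_pow_eq_order
  have hn : ((n : ℂ) + 1) ≠ 0 := Nat.cast_add_one_ne_zero n
  have h3 : ∏ m ∈ Finset.range n, (1 + 1 * (q ^ ((1 - 1) * (m + 1)) / (1 - q ^ (m + 1)) ^ 1) * v) =
      (∏ m ∈ Finset.range n, (1 + v - q ^ (m + 1) * 1)) / (n + 1) := by
    rw [← h2, ← Finset.prod_div_distrib]
    refine Finset.prod_congr rfl fun m hm => ?_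
    have := one_sub_pow_ne_zero hq m (Finset.mem_range.1 hm)
    field_simp
    simp
    ring
  have h4 : (1 + v) ^ (n + 1) - 1 =
      ∑ i ∈ Finset.range (n + 1), ((n + 1).choose (i + 1) : ℂ) * v ^ (i + 1) := by
    rw [add_comm, add_pow, Finset.sum_range_succ']
    simp [mul_comm]
  rw [one_pow, h4] at h1
  rw [add_sub_cancel_left] at h1
  rw [h3, ← mul_div_assoc, h1, Finset.sum_div]
  refine Finset.sum_congr rfl fun i _ => ?_
  push_cast
  ring

theorem succ_div_mul_choose (N K : ℕ) :
    ((N : ℂ) + 1) * N.choose K = (N + 1).choose (K + 1) * (K + 1) := by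
  exact_mod_cast Nat.add_one_mul_choose_eq N K

theorem prod_one_add_weight_two (n : ℕ) (q : ℂ) (hq : IsPrimitiveRoot q (n + 1)) :
    ∏ m ∈ Finset.range n, (1 + C (-1 * (q ^ ((2 - 1) * (m + 1)) / (1 - q ^ (m + 1)) ^ 2)) * X) =
      ∑ i ∈ Finset.range (n + 1), C (1 / ((n + 1 : ℕ) : ℂ) *
        (1 / ((i : ℂ) + 1) * ((n + 1 + i).choose (2 * i + 1) : ℂ))) * X ^ i := by
  refine prod_eq_sum_of_eval n _ _ fun v => ?_
  -- Chosen so that (1-u)² - vu = (1-ux)(1-uy) for all u.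
  obtain ⟨x, y, hs, hp⟩ := exists_add_mul_eq (2 + v) 1
  have h1 := sub_mul_prod_sub_pow n q hq 1 x
  have h1' := sub_mul_prod_sub_pow n q hq 1 y
  have h2 := hq.prod_one_sub_pow_eq_order
  have hn : ((n : ℂ) + 1) ≠ 0 := Nat.cast_add_one_ne_zero n
  have h3 : ∏ m ∈ Finset.range n, (1 + -1 * (q ^ ((2 - 1) * (m + 1)) / (1 - q ^ (m + 1)) ^ 2) * v) =
      (∏ m ∈ Finset.range n, (1 - q ^ (m + 1) * x)) *
        (∏ m ∈ Finset.range n, (1 - q ^ (m + 1) * y)) / (n + 1) ^ 2 := by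
    rw [← h2, ← Finset.prod_pow, ← Finset.prod_mul_distrib, ← Finset.prod_div_distrib]
    refine Finset.prod_congr rfl fun m hm => ?_
    have := one_sub_pow_ne_zero hq m (Finset.mem_range.1 hm)
    rw [show (2 - 1) * (m + 1) = m + 1 by omega]
    field_simp
    linear_combination q ^ (m + 1) * hs - (q ^ (m + 1)) ^ 2 * hp
  have h5 : v * ((∏ m ∈ Finset.range n, (1 - q ^ (m + 1) * x)) *
        (∏ m ∈ Finset.range n, (1 - q ^ (m + 1) * y))) = x ^ (n + 1) + y ^ (n + 1) - 2 := by
    have hpn : x ^ (n + 1) * y ^ (n + 1) = 1 := by rw [← mul_pow, hp, one_pow]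
    have hv : v = -((1 - x) * (1 - y)) := by linear_combination hp - hs
    rw [one_pow] at h1 h1'
    calc _ = -(((1 - x) * ∏ m ∈ Finset.range n, (1 - q ^ (m + 1) * x)) *
          ((1 - y) * ∏ m ∈ Finset.range n, (1 - q ^ (m + 1) * y))) := by rw [hv]; ring
      _ = _ := by rw [h1, h1']; linear_combination -hpn
  rw [h3, ← mul_div_assoc, h5, quadratic_power_sum v x y hs hp, Finset.sum_div]
  refine Finset.sum_congr rfl fun i _ => ?_
  have hi : ((i : ℂ) + 1) ≠ 0 := Nat.cast_add_one_ne_zero i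
  -- Absorption turns the power-sum coefficient, with n + 1 as order, into (n+1)/(i+1) times one
  -- binomial; this n + 1 cancels one of the two in the denominator.
  have e1 := succ_div_mul_choose (n + 1 + i) (2 * i + 1)
  have e2 : ((n + 1 + i + 1).choose (2 * i + 1 + 1) : ℂ) =
      (n + 1 + i).choose (2 * i + 1) + (n + 1 + i).choose (2 * i + 1 + 1) := by
    exact_mod_cast Nat.choose_succ_succ _ _
  rw [show 2 * i + 2 = 2 * i + 1 + 1 by ring]
  rw [← sub_eq_iff_eq_add'.2 e2]
  push_cast at e1 ⊢
  field_simp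
  linear_combination -(v ^ (i + 1)) * e1

theorem prod_one_add_weight_three (n : ℕ) (q : ℂ) (hq : IsPrimitiveRoot q (n + 1)) :
    ∏ m ∈ Finset.range n, (1 + C (-1 * (q ^ ((3 - 1) * (m + 1)) / (1 - q ^ (m + 1)) ^ 3)) * X) =
      ∑ i ∈ Finset.range (n + 1), C (1 / ((n + 1 : ℕ) : ℂ) ^ 2 *
        (1 / ((i : ℂ) + 1) * (((n + 1 + i).choose (3 * i + 2) : ℂ) +
          (-1) ^ i * ((n + 1 + 2 * i + 1).choose (3 * i + 2) : ℂ)))) * X ^ i := by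
  refine prod_eq_sum_of_eval n _ _ fun v => ?_
  -- Chosen so that (1-u)³ - vu² = (1-ux)(1-uy)(1-uz) for all u.
  obtain ⟨x, y, z, hs, ht, hp⟩ := exists_cubic_roots 3 (3 - v) 1
  have hx := sub_mul_prod_sub_pow n q hq 1 x
  have hy := sub_mul_prod_sub_pow n q hq 1 y
  have hz := sub_mul_prod_sub_pow n q hq 1 z
  have h2 := hq.prod_one_sub_pow_eq_order
  have hn : ((n : ℂ) + 1) ≠ 0 := Nat.cast_add_one_ne_zero n
  have h3 : ∏ m ∈ Finset.range n, (1 + -1 * (q ^ ((3 - 1) * (m + 1)) / (1 - q ^ (m + 1)) ^ 3) * v) =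
      (∏ m ∈ Finset.range n, (1 - q ^ (m + 1) * x)) *
        (∏ m ∈ Finset.range n, (1 - q ^ (m + 1) * y)) *
        (∏ m ∈ Finset.range n, (1 - q ^ (m + 1) * z)) / (n + 1) ^ 3 := by
    rw [← h2, ← Finset.prod_pow, ← Finset.prod_mul_distrib, ← Finset.prod_mul_distrib,
      ← Finset.prod_div_distrib]
    refine Finset.prod_congr rfl fun m hm => ?_
    have := one_sub_pow_ne_zero hq m (Finset.mem_range.1 hm)
    rw [show (3 - 1) * (m + 1) = (m + 1) * 2 by omega, pow_mul]
    field_simp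
    linear_combination q ^ (m + 1) * hs - (q ^ (m + 1)) ^ 2 * ht + (q ^ (m + 1)) ^ 3 * hp
  have hinv := cubic_power_sum_inv v (x * y) (y * z) (x * z) ht
    (by linear_combination x * y * z * hs + 3 * hp)
    (by linear_combination (x * y * z + 1) * hp) (n + 1)
  -- Expanding the product of the 1 - x^(n+1) with xyz = 1 leaves the power sums of the roots and of
  -- their reciprocals, with opposite signs; hence the two binomials.
  have h5 : v * ((∏ m ∈ Finset.range n, (1 - q ^ (m + 1) * x)) *
        (∏ m ∈ Finset.range n, (1 - q ^ (m + 1) * y)) *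
        (∏ m ∈ Finset.range n, (1 - q ^ (m + 1) * z))) =
      (x ^ (n + 1) + y ^ (n + 1) + z ^ (n + 1) - 3) -
        ((x * y) ^ (n + 1) + (y * z) ^ (n + 1) + (x * z) ^ (n + 1) - 3) := by
    have hpn : x ^ (n + 1) * y ^ (n + 1) * z ^ (n + 1) = 1 := by
      rw [← mul_pow, ← mul_pow, hp, one_pow]
    have hv : v = -((1 - x) * (1 - y) * (1 - z)) := by linear_combination ht - hs - hp
    rw [one_pow] at hx hy hz
    calc _ = -(((1 - x) * ∏ m ∈ Finset.range n, (1 - q ^ (m + 1) * x)) *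
          ((1 - y) * ∏ m ∈ Finset.range n, (1 - q ^ (m + 1) * y)) *
          ((1 - z) * ∏ m ∈ Finset.range n, (1 - q ^ (m + 1) * z))) := by rw [hv]; ring
      _ = _ := by rw [hx, hy, hz, mul_pow, mul_pow, mul_pow]; linear_combination hpn
  rw [h3, ← mul_div_assoc, h5, cubic_power_sum v x y z hs ht hp, hinv, ← Finset.sum_sub_distrib,
    Finset.sum_div]
  refine Finset.sum_congr rfl fun i _ => ?_
  have hi : ((i : ℂ) + 1) ≠ 0 := Nat.cast_add_one_ne_zero i
  have e1 := succ_div_mul_choose (n + 1 + i) (3 * i + 2)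
  have e2 := succ_div_mul_choose (n + 1 + 2 * i + 1) (3 * i + 2)
  rw [show 3 * i + 3 = 3 * i + 2 + 1 by ring,
    show n + 1 + 2 * i + 2 = n + 1 + 2 * i + 1 + 1 by ring]
  push_cast at e1 e2 ⊢
  field_simp
  linear_combination -(v ^ (i + 1)) * e1 - v ^ (i + 1) * (-1) ^ i * e2

/-! ### Extracting the powers of n and conclusion. -/

theorem sum_boundedCompositions_scale (c N : ℂ) (n l m : ℕ) (d : ℕ → ℂ)
    (α β : ℂ[X]) (hc : c * (1 / N) ^ (m + 1) = c / N ^ (m + 1)) :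
    C c * ∑ i ∈ boundedCompositions n l m,
        C (∏ a, 1 / N * d (i a)) * (α ^ i 0 * β ^ (l - i 0)) =
      C (c / N ^ (m + 1)) * ∑ i ∈ boundedCompositions n l m,
        C (∏ a, d (i a)) * (α ^ i 0 * β ^ (l - i 0)) := by
  rw [← hc, C_mul, mul_assoc]
  simp only [Finset.mul_sum]
  refine Finset.sum_congr rfl fun i _ => ?_
  rw [Finset.prod_mul_distrib, Finset.prod_const, Finset.card_univ, Fintype.card_fin, C_mul,
    mul_assoc]

theorem corollary1p5 (n : ℕ) (hn : 1 ≤ n) (ζ : ℂ) (hζ : IsPrimitiveRoot ζ n) (l : ℕ) :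
    zbarT n ζ (List.replicate l 1) =
      ∑ m ∈ Finset.range (l + 1), C ((-1 : ℂ) ^ m / (n : ℂ) ^ (m + 1)) *
        ∑ i ∈ boundedCompositions n l m,
          C (∏ a, (n.choose (i a + 1) : ℂ)) * ((1 - X) ^ i 0 * (-X) ^ (l - i 0)) ∧
    zbarT n ζ (List.replicate l 2) =
      ∑ m ∈ Finset.range (l + 1), C ((-1 : ℂ) ^ m / (n : ℂ) ^ (m + 1)) *
        ∑ i ∈ boundedCompositions n l m,
          C (∏ a, 1 / ((i a : ℂ) + 1) * ((n + i a).choose (2 * i a + 1) : ℂ)) *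
            ((X - 1) ^ i 0 * X ^ (l - i 0)) ∧
    zbarT n ζ (List.replicate l 3) =
      ∑ m ∈ Finset.range (l + 1), C ((-1 : ℂ) ^ m / (n : ℂ) ^ (2 * m + 2)) *
        ∑ i ∈ boundedCompositions n l m,
          C (∏ a, 1 / ((i a : ℂ) + 1) *
            (((n + i a).choose (3 * i a + 2) : ℂ) +
              (-1) ^ i a * ((n + 2 * i a + 1).choose (3 * i a + 2) : ℂ))) *
            ((X - 1) ^ i 0 * X ^ (l - i 0)) := by
  obtain ⟨n, rfl⟩ := Nat.exists_eq_add_of_le' hn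
  have hq := one_sub_pow_ne_zero hζ
  have e1 : (C (-1) * (1 - X) : ℂ[X]) = X - 1 := by rw [C_neg, C_1]; ring
  have e2 : (C (-1) * -X : ℂ[X]) = X := by rw [C_neg, C_1]; ring
  refine ⟨?_, ?_, ?_⟩
  · rw [zbarT_replicate_eq n ζ 1 le_rfl hq 1 (by norm_num) _ (prod_one_add_weight_one n ζ hζ)]
    refine Finset.sum_congr rfl fun m _ => ?_
    rw [C_1, one_mul, one_mul]
    exact sum_boundedCompositions_scale _ _ _ _ _ (fun i => ((n + 1).choose (i + 1) : ℂ)) _ _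
      (by rw [one_div, inv_pow, div_eq_mul_inv])
  · rw [zbarT_replicate_eq n ζ 2 (by norm_num) hq (-1) (by norm_num) _
      (prod_one_add_weight_two n ζ hζ), e1, e2]
    refine Finset.sum_congr rfl fun m _ => ?_
    exact sum_boundedCompositions_scale _ _ _ _ _
      (fun i => 1 / ((i : ℂ) + 1) * ((n + 1 + i).choose (2 * i + 1) : ℂ)) _ _
      (by rw [one_div, inv_pow, div_eq_mul_inv])
  · rw [zbarT_replicate_eq n ζ 3 (by norm_num) hq (-1) (by norm_num) _
      (prod_one_add_weight_three n ζ hζ), e1, e2]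
    refine Finset.sum_congr rfl fun m _ => ?_
    -- For k = 3 each of the m + 1 coefficients carries 1/n² instead of 1/n.
    rw [show 2 * m + 2 = 2 * (m + 1) by ring, pow_mul]
    exact sum_boundedCompositions_scale _ _ _ _ _
      (fun i => 1 / ((i : ℂ) + 1) * (((n + 1 + i).choose (3 * i + 2) : ℂ) +
          (-1) ^ i * ((n + 1 + 2 * i + 1).choose (3 * i + 2) : ℂ))) _ _
      (by rw [one_div, inv_pow, div_eq_mul_inv])
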